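/- All graphs are loopless and without parallel edges. An orientation of a graph $G$ chooses exactly one of the two directions for every edge of $G$; it is $T_3$-free if it contains no transitive triangle, i.e. no three vertices $a,b,c$ with arcs $a\to b$, $b\to c$, $a\to c$. Let $P=x_1\cdots x_n$ and $Q=y_1\cdots y_m$ be two disjoint paths with $n,m\ge 1$ and $n+m\ge 4$ (a path may consist of a single vertex). Draw $P$ and $Q$ from left to right on two distinct parallel lines of the plane, add the straight edges $x_1y_1$ and $x_ny_m$, and triangulate the strip between them by straight edges, each with one end in $P$ and the other in $Q$ (that is, the edges between $P$ and $Q$ form a maximal set of pairwise non-crossing segments). Any graph $J$ isomorphic to a graph obtained in this way is called a t-join of $P$ and $Q$. Identifying $x_1$ with $x_n$ and $y_1$ with $y_m$ in $J$ gives a donut; identifying $x_1$ with $y_m$ and $y_1$ with $x_n$ gives a Möbius donut. Parallel edges that arise are merged, and only those donuts and Möbius donuts are considered in which no loop arises, i.e. no two adjacent vertices of $J$ are identified. A donut or Möbius donut obtained from $J$ is called even or odd according to the parity of the number of triangles of $J$. **Theorem.** Let $\mathcal F$ be the set of all odd donuts and all even Möbius donuts. A graph $G$ admits a $T_3$-free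 orientation if and only if there is no $D\in\mathcal F$ that admits a homomorphism $D\to G$. -/

import Mathlib

namespace TriangleOrient

/-! ### Orientations and forbidden oriented graphs -/

/-- `D` is an orientation of the graph `G`: every edge of `G` receives exactly one of its two
directions, and `D` has no other arcs. -/
def IsOrientation {V : Type*} (D : Digraph V) (G : SimpleGraph V) : Prop :=
  (∀ u v, G.Adj u v ↔ D.Adj u v ∨ D.Adj v u) ∧ ∀ u v, D.Adj u v → ¬ D.Adj v u

/-- `D` is `F`-free: no induced subdigraph of `D` is isomorphic to `F`. -/
def IsFree {U V : Type*} (F : Digraph U) (D : Digraph V) : Prop :=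
  IsEmpty (F.Adj ↪r D.Adj)

/-- The transitive tournament on three vertices, with arcs `0 → 1`, `1 → 2`, `0 → 2`. -/
def T3 : Digraph (Fin 3) where
  Adj i j := i < j

/-! ### t-joins of two paths -/

/-- The open straight segment between the point of abscissa `a` on the line `y = 0` and the point
of abscissa `b` on the line `y = 1`. -/
def chordSegment (a b : ℝ) : Set (ℝ × ℝ) :=
  openSegment ℝ ((a, 0) : ℝ × ℝ) ((b, 1) : ℝ × ℝ)

/-- A t-embedding of a path `P` with vertices `0, …, n` and a path `Q` with vertices `0, …, m`.
The path `P` is drawn from left to right on the line `y = 0` and `Q` from left to right on the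
parallel line `y = 1`. The pair `(i, j)` is a chord if the segment from the `i`-th vertex of `P`
to the `j`-th vertex of `Q` is drawn. The first vertices are joined, the last vertices are
joined, and the chords triangulate the strip between them: distinct chords do not meet, except
possibly at their ends, and no further chord can be drawn without crossing one of them. -/
structure TEmbedding (n m : ℕ) where
  posP : Fin (n + 1) → ℝ
  posQ : Fin (m + 1) → ℝ
  strictMono_posP : StrictMono posP
  strictMono_posQ : StrictMono posQ
  chords : Set (Fin (n + 1) × Fin (m + 1))
  first_mem : (0, 0) ∈ chords
  last_mem : (Fin.last n, Fin.last m) ∈ chords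
  noncrossing : ∀ e ∈ chords, ∀ f ∈ chords, e ≠ f →
    Disjoint (chordSegment (posP e.1) (posQ e.2)) (chordSegment (posP f.1) (posQ f.2))
  maximal : ∀ e, e ∉ chords → ∃ f ∈ chords,
    ¬ Disjoint (chordSegment (posP e.1) (posQ e.2)) (chordSegment (posP f.1) (posQ f.2))

/-- The t-join: the graph formed by the two paths and the chords of a t-embedding. -/
def TEmbedding.graph {n m : ℕ} (T : TEmbedding n m) : SimpleGraph (Fin (n + 1) ⊕ Fin (m + 1)) :=
  (SimpleGraph.pathGraph (n + 1) ⊕g SimpleGraph.pathGraph (m + 1)) ⊔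
    SimpleGraph.fromRel fun u v => ∃ e ∈ T.chords, u = Sum.inl e.1 ∧ v = Sum.inr e.2

/-- The number of triangles of a t-join. -/
noncomputable def TEmbedding.numTriangles {n m : ℕ} (T : TEmbedding n m) : ℕ :=
  (T.graph.cliqueSet 3).ncard

/-! ### Donuts and Möbius donuts -/

/-- The identifications of a donut: first with last vertex of `P`, first with last vertex of `Q`. -/
inductive DonutRel (n m : ℕ) : Fin (n + 1) ⊕ Fin (m + 1) → Fin (n + 1) ⊕ Fin (m + 1) → Prop
  | left : DonutRel n m (Sum.inl 0) (Sum.inl (Fin.last n))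
  | right : DonutRel n m (Sum.inr 0) (Sum.inr (Fin.last m))

/-- The identifications of a Möbius donut: first vertex of `P` with last vertex of `Q`, first
vertex of `Q` with last vertex of `P`. -/
inductive MobiusRel (n m : ℕ) : Fin (n + 1) ⊕ Fin (m + 1) → Fin (n + 1) ⊕ Fin (m + 1) → Prop
  | left : MobiusRel n m (Sum.inl 0) (Sum.inr (Fin.last m))
  | right : MobiusRel n m (Sum.inr 0) (Sum.inl (Fin.last n))

/-- `D` is (isomorphic to) the graph obtained from `H` by identifying the vertices related by `r`,
and this identification creates no loop. -/
def IsLooplessQuotient {U W : Type*} (H : SimpleGraph U) (r : U → U → Prop)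
    (D : SimpleGraph W) : Prop :=
  (∀ u v, H.Adj u v → Quot.mk r u ≠ Quot.mk r v) ∧ Nonempty (H.map (Quot.mk r) ≃g D)

/-- Odd donuts: loopless donuts whose spanning t-join has an odd number of triangles. The two
underlying paths have at least four vertices in total. -/
def IsOddDonut {W : Type*} (D : SimpleGraph W) : Prop :=
  ∃ (n m : ℕ) (T : TEmbedding n m), 4 ≤ (n + 1) + (m + 1) ∧ Odd T.numTriangles ∧
    IsLooplessQuotient T.graph (DonutRel n m) D

/-- Even Möbius donuts: loopless Möbius donuts whose spanning t-join has an even number of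
triangles. The two underlying paths have at least four vertices in total. -/
def IsEvenMobiusDonut {W : Type*} (D : SimpleGraph W) : Prop :=
  ∃ (n m : ℕ) (T : TEmbedding n m), 4 ≤ (n + 1) + (m + 1) ∧ Even T.numTriangles ∧
    IsLooplessQuotient T.graph (MobiusRel n m) D

end TriangleOrient

/-!
A `T3`-free orientation makes every triangle a directed cycle, so the direction of one edge of a
triangle determines the other two. A t-join propagates this information: two open chords are
disjoint exactly when they are distinct and comparable in the product order
(`disjoint_chordSegment_iff`), so the chords of a t-embedding form a maximal chain of
`Fin (n + 1) × Fin (m + 1)`, that is, a lattice path with unit steps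
(`TEmbedding.exists_chord_sequence`). Its `n + m` steps correspond to the triangles of the t-join
(`TEmbedding.numTriangles_eq`), and each step switches whether the chord points from `P` to `Q`
(`TEmbedding.adj_last_iff`). Closing up an odd number of steps without a twist, or an even number
with a twist, is therefore contradictory, so no odd donut and no even Möbius donut maps to a graph
with a `T3`-free orientation.

Conversely, call two arcs equivalent if one is reached from the other by rotating inside triangles
of `G` (`Rotates`). If no arc is equivalent to its reverse, choosing one class from each pair of
opposite classes gives a `T3`-free orientation (`exists_isFree_of_not_rotates`). If some arc is
equivalent to its reverse, the rotations trace out a strip of triangles in `G`, one triangle per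
rotation, where every rotation exchanges the two sides of the strip
(`exists_hasStrip_of_rotates`). After an even number of rotations the arc arrives reversed on the
strip as well, which gives an even Möbius donut; after an odd number the exchange of sides undoes
the reversal, which gives an odd donut.
-/

namespace TriangleOrient

/-! ### Crossing chords -/

theorem mem_chordSegment_iff {a b : ℝ} {p : ℝ × ℝ} :
    p ∈ chordSegment a b ↔ (0 < p.2 ∧ p.2 < 1) ∧ p.1 = (1 - p.2) * a + p.2 * b := by
  rw [chordSegment, openSegment_eq_image]
  constructor
  · rintro ⟨t, ⟨h0, h1⟩, rfl⟩
    simp [h0, h1]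
  · rintro ⟨⟨h0, h1⟩, h⟩
    exact ⟨p.2, ⟨h0, h1⟩, by ext <;> simp [h]⟩

theorem disjoint_chordSegment_of_lt {a b a' b' : ℝ} (h : ((a, b) : ℝ × ℝ) < (a', b')) :
    Disjoint (chordSegment a b) (chordSegment a' b') := by
  rw [Set.disjoint_left]
  intro p hp hp'
  obtain ⟨⟨h0, h1⟩, e⟩ := mem_chordSegment_iff.1 hp
  obtain ⟨-, e'⟩ := mem_chordSegment_iff.1 hp'
  have h1' : 0 < 1 - p.2 := by linarith
  rcases Prod.mk_lt_mk.1 h with ⟨ha, hb⟩ | ⟨ha, hb⟩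
  · have := mul_lt_mul_of_pos_left ha h1'
    have := mul_le_mul_of_nonneg_left hb h0.le
    linarith
  · have := mul_le_mul_of_nonneg_left ha h1'.le
    have := mul_lt_mul_of_pos_left hb h0
    linarith

theorem not_disjoint_chordSegment_of_lt {a b a' b' : ℝ} (ha : a < a') (hb : b' < b) :
    ¬ Disjoint (chordSegment a b) (chordSegment a' b') := by
  have hd : 0 < (a' - a) + (b - b') := by linarith
  -- the height at which the two lines meet
  set t : ℝ := (a' - a) / ((a' - a) + (b - b')) with ht
  have h0 : 0 < t := div_pos (by linarith) hd
  have h1 : t < 1 := (div_lt_one hd).2 (by linarith)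
  have key : t * ((a' - a) + (b - b')) = a' - a := div_mul_cancel₀ _ hd.ne'
  rw [Set.not_disjoint_iff]
  exact ⟨((1 - t) * a + t * b, t), mem_chordSegment_iff.2 ⟨⟨h0, h1⟩, rfl⟩,
    mem_chordSegment_iff.2 ⟨⟨h0, h1⟩, by simp only; linarith⟩⟩

/-- Two open chords are disjoint exactly when they are distinct and comparable in the product
order. Chords sharing an end are comparable; a chord is not disjoint from itself. -/
theorem disjoint_chordSegment_iff {n m : ℕ} {p : Fin (n + 1) → ℝ} {q : Fin (m + 1) → ℝ}
    (hp : StrictMono p) (hq : StrictMono q) (e f : Fin (n + 1) × Fin (m + 1)) :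
    Disjoint (chordSegment (p e.1) (q e.2)) (chordSegment (p f.1) (q f.2)) ↔ e < f ∨ f < e := by
  constructor
  · intro h
    by_contra hne
    rcases lt_trichotomy e.1 f.1 with h1 | h1 | h1 <;>
      rcases lt_trichotomy e.2 f.2 with h2 | h2 | h2
    case inl.inr.inr => exact not_disjoint_chordSegment_of_lt (hp h1) (hq h2) h
    case inr.inr.inl => exact not_disjoint_chordSegment_of_lt (hp h1) (hq h2) h.symm
    case inr.inl.inr.inl =>
      obtain rfl : e = f := Prod.ext h1 h2
      -- a chord meets itself at height `1 / 2`
      have hm := mem_chordSegment_iff (a := p e.1) (b := q e.2)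
        (p := ((1 - 1 / 2) * p e.1 + 1 / 2 * q e.2, 1 / 2))
      exact Set.disjoint_left.1 h (hm.2 (by norm_num)) (hm.2 (by norm_num))
    all_goals simp [Prod.lt_iff, h1, h2, h1.le, h2.le] at hne
  · have aux : ∀ e f : Fin (n + 1) × Fin (m + 1), e < f →
        Disjoint (chordSegment (p e.1) (q e.2)) (chordSegment (p f.1) (q f.2)) := by
      intro e f h
      apply disjoint_chordSegment_of_lt
      rcases Prod.lt_iff.1 h with ⟨h1, h2⟩ | ⟨h1, h2⟩
      · exact Prod.mk_lt_mk.2 (.inl ⟨hp h1, hq.monotone h2⟩)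
      · exact Prod.mk_lt_mk.2 (.inr ⟨hp.monotone h1, hq h2⟩)
    rintro (h | h)
    · exact aux e f h
    · exact (aux f e h).symm

/-! ### The chords of a t-embedding form a lattice path -/

namespace TEmbedding

variable {n m : ℕ} (T : TEmbedding n m)

theorem le_or_le_of_mem {e f : Fin (n + 1) × Fin (m + 1)} (he : e ∈ T.chords)
    (hf : f ∈ T.chords) : e ≤ f ∨ f ≤ e := by
  by_cases h : e = f
  · exact .inl h.le
  · exact ((disjoint_chordSegment_iff T.strictMono_posP T.strictMono_posQ e f).1
      (T.noncrossing e he f hf h)).imp le_of_lt le_of_lt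

theorem mem_of_comparable {e : Fin (n + 1) × Fin (m + 1)}
    (h : ∀ f ∈ T.chords, e ≤ f ∨ f ≤ e) : e ∈ T.chords := by
  by_contra he
  obtain ⟨f, hf, hd⟩ := T.maximal e he
  have hne : e ≠ f := fun h => he (h ▸ hf)
  refine hd ((disjoint_chordSegment_iff T.strictMono_posP T.strictMono_posQ e f).2 ?_)
  exact (h f hf).imp (lt_of_le_of_ne · hne) (lt_of_le_of_ne · hne.symm)

theorem eq_of_rank_eq {e f : Fin (n + 1) × Fin (m + 1)} (he : e ∈ T.chords) (hf : f ∈ T.chords)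
    (h : (e.1 : ℕ) + e.2 = f.1 + f.2) : e = f := by
  rcases T.le_or_le_of_mem he hf with hl | hl <;> have h1 := Fin.le_def.1 hl.1 <;>
    have h2 := Fin.le_def.1 hl.2 <;> ext <;> omega

/-- A chord other than the last one is followed by a chord that advances by one vertex on exactly
one of the two paths: if neither of the two candidates were a chord, then a chord on the far side
of the first would cross a chord on the far side of the second. -/
theorem exists_succ {e : Fin (n + 1) × Fin (m + 1)} (he : e ∈ T.chords)
    (hlt : (e.1 : ℕ) + e.2 < n + m) :
    ∃ f ∈ T.chords, ((f.1 : ℕ) = e.1 + 1 ∧ f.2 = e.2) ∨ (f.1 = e.1 ∧ (f.2 : ℕ) = e.2 + 1) := by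
  by_contra! hno
  have hl := T.le_or_le_of_mem he T.last_mem
  -- as `P` cannot be advanced, some later chord keeps the end on `P`; if `P` is exhausted, the
  -- last chord does
  have hA : ∃ g ∈ T.chords, g.1 = e.1 ∧ e.2 < g.2 := by
    by_cases hn : (e.1 : ℕ) < n
    · have ha : ((⟨e.1 + 1, by omega⟩, e.2) : Fin (n + 1) × Fin (m + 1)) ∉ T.chords :=
        fun h => (hno _ h).1 rfl rfl
      by_contra! hg
      refine ha (T.mem_of_comparable fun f hf => ?_)
      have := hg f hf
      have := hno f hf
      have := T.le_or_le_of_mem he hf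
      simp only [Prod.le_def, Fin.le_def, Fin.ext_iff] at *
      omega
    · refine ⟨_, T.last_mem, ?_⟩
      simp only [Fin.lt_def, Fin.ext_iff, Fin.val_last]
      omega
  -- symmetrically for `Q`
  have hB : ∃ g ∈ T.chords, g.2 = e.2 ∧ e.1 < g.1 := by
    by_cases hn : (e.2 : ℕ) < m
    · have ha : ((e.1, ⟨e.2 + 1, by omega⟩) : Fin (n + 1) × Fin (m + 1)) ∉ T.chords :=
        fun h => (hno _ h).2 rfl rfl
      by_contra! hg
      refine ha (T.mem_of_comparable fun f hf => ?_)
      have := hg f hf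
      have := hno f hf
      have := T.le_or_le_of_mem he hf
      simp only [Prod.le_def, Fin.le_def, Fin.ext_iff] at *
      omega
    · refine ⟨_, T.last_mem, ?_⟩
      simp only [Fin.lt_def, Fin.ext_iff, Fin.val_last]
      omega
  obtain ⟨g, hg, g1, g2⟩ := hA
  obtain ⟨g', hg', g1', g2'⟩ := hB
  have := T.le_or_le_of_mem hg hg'
  simp only [Prod.le_def, Fin.le_def, Fin.lt_def, Fin.ext_iff] at *
  omega

/-- The chords of a t-embedding, listed from left to right, form a lattice path with unit steps. -/
theorem exists_chord_sequence : ∃ c : ℕ → Fin (n + 1) × Fin (m + 1),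
    c 0 = (0, 0) ∧ c (n + m) = (Fin.last n, Fin.last m) ∧
    (∀ k ≤ n + m, c k ∈ T.chords ∧ ((c k).1 : ℕ) + (c k).2 = k) ∧
    ∀ k < n + m, (((c (k + 1)).1 : ℕ) = (c k).1 + 1 ∧ (c (k + 1)).2 = (c k).2) ∨
      ((c (k + 1)).1 = (c k).1 ∧ ((c (k + 1)).2 : ℕ) = (c k).2 + 1) := by
  have hex : ∀ k, k ≤ n + m → ∃ e ∈ T.chords, (e.1 : ℕ) + e.2 = k := by
    intro k
    induction k with
    | zero => exact fun _ => ⟨_, T.first_mem, rfl⟩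
    | succ k ih =>
      intro hk
      obtain ⟨e, he, hek⟩ := ih (by omega)
      obtain ⟨f, hf, h⟩ := T.exists_succ he (by omega)
      refine ⟨f, hf, ?_⟩
      simp only [Fin.ext_iff] at h
      omega
  choose! c hc using hex
  refine ⟨c, ?_, ?_, hc, fun k hk => ?_⟩
  · exact T.eq_of_rank_eq (hc 0 (by omega)).1 T.first_mem (hc 0 (by omega)).2
  · exact T.eq_of_rank_eq (hc _ le_rfl).1 T.last_mem (hc _ le_rfl).2
  · obtain ⟨f, hf, h⟩ := T.exists_succ (hc k hk.le).1 (by have := (hc k hk.le).2; omega)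
    obtain rfl : c (k + 1) = f := by
      refine T.eq_of_rank_eq (hc _ hk).1 hf ?_
      rw [(hc _ hk).2]
      have := (hc k hk.le).2
      simp only [Fin.ext_iff] at h
      omega
    exact h

/-! ### The triangles of a t-join -/

@[simp]
theorem graph_adj_inl_inl {i j : Fin (n + 1)} : T.graph.Adj (Sum.inl i) (Sum.inl j) ↔
    (i : ℕ) + 1 = j ∨ (j : ℕ) + 1 = i := by
  simp [graph, SimpleGraph.pathGraph_adj]

@[simp]
theorem graph_adj_inr_inr {i j : Fin (m + 1)} : T.graph.Adj (Sum.inr i) (Sum.inr j) ↔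
    (i : ℕ) + 1 = j ∨ (j : ℕ) + 1 = i := by
  simp [graph, SimpleGraph.pathGraph_adj]

@[simp]
theorem graph_adj_inl_inr {i : Fin (n + 1)} {j : Fin (m + 1)} :
    T.graph.Adj (Sum.inl i) (Sum.inr j) ↔ (i, j) ∈ T.chords := by
  simp [graph]

@[simp]
theorem graph_adj_inr_inl {i : Fin (n + 1)} {j : Fin (m + 1)} :
    T.graph.Adj (Sum.inr j) (Sum.inl i) ↔ (i, j) ∈ T.chords := by
  rw [SimpleGraph.adj_comm, graph_adj_inl_inr]

/-- Each step between consecutive chords cuts off one triangle, and there are no others: a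
triangle contains an edge of one path and a vertex of the other, hence two consecutive chords. -/
theorem numTriangles_eq : T.numTriangles = n + m := by
  obtain ⟨c, -, -, hc, hstep⟩ := T.exists_chord_sequence
  let tri : ℕ → Finset (Fin (n + 1) ⊕ Fin (m + 1)) := fun k =>
    {Sum.inl (c k).1, Sum.inr (c k).2, Sum.inl (c (k + 1)).1, Sum.inr (c (k + 1)).2}
  -- two chords of consecutive ranks are consecutive members of the sequence
  have hfind : ∀ e ∈ T.chords, ∀ f ∈ T.chords, (f.1 : ℕ) + f.2 = e.1 + e.2 + 1 →
      ∃ k < n + m, c k = e ∧ c (k + 1) = f := by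
    intro e he f hf h
    have h1 := f.1.isLt
    have h2 := f.2.isLt
    have hk : (e.1 : ℕ) + e.2 < n + m := by omega
    exact ⟨e.1 + e.2, hk, T.eq_of_rank_eq (hc _ hk.le).1 he (hc _ hk.le).2,
      T.eq_of_rank_eq (hc _ hk).1 hf ((hc _ hk).2.trans h.symm)⟩
  have hP : ∀ (i i' : Fin (n + 1)) (j : Fin (m + 1)), (i, j) ∈ T.chords → (i', j) ∈ T.chords →
      (i : ℕ) + 1 = i' → ({.inl i, .inl i', .inr j} : Finset _) ∈ tri '' Set.Iio (n + m) := by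
    intro i i' j h h' hi
    obtain ⟨k, hk, e, f⟩ := hfind _ h _ h' (by simp only; omega)
    refine ⟨k, hk, ?_⟩
    simp only [tri, e, f]
    ext v
    simp only [Finset.mem_insert, Finset.mem_singleton]
    tauto
  have hQ : ∀ (i : Fin (n + 1)) (j j' : Fin (m + 1)), (i, j) ∈ T.chords → (i, j') ∈ T.chords →
      (j : ℕ) + 1 = j' → ({.inr j, .inr j', .inl i} : Finset _) ∈ tri '' Set.Iio (n + m) := by
    intro i j j' h h' hj
    obtain ⟨k, hk, e, f⟩ := hfind _ h _ h' (by simp only; omega)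
    refine ⟨k, hk, ?_⟩
    simp only [tri, e, f]
    ext v
    simp only [Finset.mem_insert, Finset.mem_singleton]
    tauto
  have hP' : ∀ (i i' : Fin (n + 1)) (j : Fin (m + 1)), T.graph.Adj (.inl i) (.inl i') →
      (i, j) ∈ T.chords → (i', j) ∈ T.chords →
      ({.inl i, .inl i', .inr j} : Finset _) ∈ tri '' Set.Iio (n + m) := by
    intro i i' j hi h h'
    rcases T.graph_adj_inl_inl.1 hi with hi | hi
    · exact hP i i' j h h' hi
    · rw [Finset.insert_comm]
      exact hP i' i j h' h hi
  have hQ' : ∀ (i : Fin (n + 1)) (j j' : Fin (m + 1)), T.graph.Adj (.inr j) (.inr j') →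
      (i, j) ∈ T.chords → (i, j') ∈ T.chords →
      ({.inr j, .inr j', .inl i} : Finset _) ∈ tri '' Set.Iio (n + m) := by
    intro i j j' hj h h'
    rcases T.graph_adj_inr_inr.1 hj with hj | hj
    · exact hQ i j j' h h' hj
    · rw [Finset.insert_comm]
      exact hQ i j' j h' h hj
  have himage : T.graph.cliqueSet 3 = tri '' Set.Iio (n + m) := by
    apply Set.Subset.antisymm
    · intro s hs
      obtain ⟨u, v, w, huv, huw, hvw, rfl⟩ := SimpleGraph.is3Clique_iff.1 hs
      rcases u with u | u <;> rcases v with v | v <;> rcases w with w | w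
      · simp only [graph_adj_inl_inl] at huv huw hvw
        omega
      · exact hP' u v w huv (by simpa using huw) (by simpa using hvw)
      · rw [Finset.pair_comm]
        exact hP' u w v huw (by simpa using huv) (by simpa using hvw)
      · rw [Finset.insert_comm, Finset.pair_comm]
        exact hQ' u v w hvw (by simpa using huv) (by simpa using huw)
      · rw [Finset.insert_comm, Finset.pair_comm]
        exact hP' v w u hvw (by simpa using huv) (by simpa using huw)
      · rw [Finset.pair_comm]
        exact hQ' v u w huw (by simpa using huv) (by simpa using hvw)
      · exact hQ' w u v huv (by simpa using huw) (by simpa using hvw)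
      · simp only [graph_adj_inr_inr] at huv huw hvw
        omega
    · rintro _ ⟨k, hk, rfl⟩
      have h0 := (hc k (le_of_lt hk)).1
      have h1 := (hc (k + 1) hk).1
      rw [SimpleGraph.mem_cliqueSet_iff, SimpleGraph.is3Clique_iff]
      rcases hstep k hk with ⟨h, h'⟩ | ⟨h, h'⟩
      · refine ⟨.inl (c k).1, .inr (c k).2, .inl (c (k + 1)).1, by simpa using h0, ?_, ?_, ?_⟩
        · rw [graph_adj_inl_inl]; omega
        · rw [graph_adj_inr_inl, ← h']; exact h1
        · simp only [tri, h']
          ext v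
          simp only [Finset.mem_insert, Finset.mem_singleton]
          tauto
      · refine ⟨.inl (c k).1, .inr (c k).2, .inr (c (k + 1)).2, by simpa using h0, ?_, ?_, ?_⟩
        · rw [graph_adj_inl_inr, ← h]; exact h1
        · rw [graph_adj_inr_inr]; omega
        · simp only [tri, h]
          ext v
          simp only [Finset.mem_insert, Finset.mem_singleton]
          tauto
  -- the least chord inside the `k`-th triangle is the `k`-th one
  have hle : ∀ k < n + m, ∀ l < n + m, tri k = tri l → l ≤ k := by
    intro k hk l hl h
    have h1 : Sum.inl (c k).1 ∈ tri l := by rw [← h]; simp [tri]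
    have h2 : Sum.inr (c k).2 ∈ tri l := by rw [← h]; simp [tri]
    have := hstep l hl
    have := (hc k (le_of_lt hk)).2
    have := (hc l (le_of_lt hl)).2
    simp only [tri, Finset.mem_insert, Finset.mem_singleton, Sum.inl.injEq, Sum.inr.injEq,
      reduceCtorEq, false_or, or_false, Fin.ext_iff] at *
    omega
  have hinj : Set.InjOn tri (Set.Iio (n + m)) := fun k hk l hl h =>
    le_antisymm (hle l hl k hk h.symm) (hle k hk l hl h)
  rw [numTriangles, himage, hinj.ncard_image]
  simp

end TEmbedding

/-! ### Homomorphisms from quotients -/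

section Quotient

variable {U W V : Type*} {H : SimpleGraph U} {r : U → U → Prop} {D : SimpleGraph W}
  {G : SimpleGraph V}

/-- A homomorphism from a quotient of `H` is a homomorphism from `H` that respects the
identifications. -/
theorem IsLooplessQuotient.exists_hom (h : IsLooplessQuotient H r D) (φ : D →g G) :
    ∃ ψ : H →g G, ∀ u v, r u v → ψ u = ψ v := by
  obtain ⟨hloop, ⟨i⟩⟩ := h
  exact ⟨⟨fun u => φ (i (Quot.mk r u)), fun {u v} huv => φ.map_rel
    (i.map_rel_iff.2 (SimpleGraph.map_adj_apply' huv (hloop u v huv)))⟩,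
    fun u v huv => congrArg (fun x => φ (i x)) (Quot.sound huv)⟩

/-- Identifying vertices with the same image under a homomorphism into a loopless graph creates
no loop. -/
theorem isLooplessQuotient_of_hom (φ : H →g G) (hr : ∀ u v, r u v → φ u = φ v) :
    IsLooplessQuotient H r (H.map (Quot.mk r)) ∧ Nonempty (H.map (Quot.mk r) →g G) := by
  refine ⟨⟨fun u v huv h => ?_, ⟨SimpleGraph.Iso.refl⟩⟩, ⟨⟨Quot.lift φ hr, ?_⟩⟩⟩
  · exact (φ.map_rel huv).ne (congrArg (Quot.lift φ hr) h)
  · rintro _ _ ⟨-, u, v, huv, rfl, rfl⟩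
    exact φ.map_rel huv

end Quotient

/-! ### A triangle-cyclic orientation alternates along the chords -/

theorem not_adj_of_isFree {V : Type*} {G : SimpleGraph V} {O : Digraph V}
    (hO : IsOrientation O G) (hfree : IsFree T3 O) {a b c : V} (hab : O.Adj a b)
    (hbc : O.Adj b c) : ¬ O.Adj a c := by
  intro hac
  have irr : ∀ x, ¬ O.Adj x x := fun x h => hO.2 x x h h
  have nab : a ≠ b := by rintro rfl; exact irr _ hab
  have nbc : b ≠ c := by rintro rfl; exact irr _ hbc
  have nac : a ≠ c := by rintro rfl; exact irr _ hac
  have hba := hO.2 _ _ hab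
  have hcb := hO.2 _ _ hbc
  have hca := hO.2 _ _ hac
  refine hfree.false ⟨⟨![a, b, c], fun i j h => ?_⟩, fun {i j} => ?_⟩
  · fin_cases i <;> fin_cases j <;> simp_all
  · change O.Adj (![a, b, c] i) (![a, b, c] j) ↔ i < j
    fin_cases i <;> fin_cases j <;> simp [irr, hab, hbc, hac, hba, hcb, hca]

/-- In a `T3`-free orientation every triangle is a directed cycle. -/
theorem adj_iff_of_isFree {V : Type*} {G : SimpleGraph V} {O : Digraph V}
    (hO : IsOrientation O G) (hfree : IsFree T3 O) {a b c : V} (hab : G.Adj a b)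
    (hbc : G.Adj b c) (hac : G.Adj a c) : O.Adj a b ↔ O.Adj b c := by
  have fwd : ∀ {a b c}, G.Adj b c → G.Adj a c → O.Adj a b → O.Adj b c := by
    intro a b c hbc hac h
    refine ((hO.1 _ _).1 hbc).resolve_right fun hcb => ?_
    rcases (hO.1 _ _).1 hac with h' | h'
    · exact not_adj_of_isFree hO hfree h' hcb h
    · exact not_adj_of_isFree hO hfree h' h hcb
  exact ⟨fwd hbc hac, fun h => fwd hab hbc.symm (fwd hac.symm hab.symm h)⟩

/-- The direction of the last chord agrees with that of the first exactly when the number of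
triangles is even. -/
theorem TEmbedding.adj_last_iff {V : Type*} {G : SimpleGraph V} {O : Digraph V}
    (hO : IsOrientation O G) (hfree : IsFree T3 O) {n m : ℕ} (T : TEmbedding n m)
    (φ : T.graph →g G) :
    (O.Adj (φ (.inl (Fin.last n))) (φ (.inr (Fin.last m))) ↔ O.Adj (φ (.inl 0)) (φ (.inr 0))) ↔
      Even (n + m) := by
  obtain ⟨c, h0, hlast, hc, hstep⟩ := T.exists_chord_sequence
  have anti : ∀ a b, G.Adj a b → (O.Adj a b ↔ ¬ O.Adj b a) := fun a b h =>
    ⟨hO.2 a b, ((hO.1 a b).1 h).resolve_right⟩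
  suffices h : ∀ k ≤ n + m, (O.Adj (φ (.inl (c k).1)) (φ (.inr (c k).2)) ↔
      O.Adj (φ (.inl (c 0).1)) (φ (.inr (c 0).2))) ↔ Even k by
    simpa [h0, hlast] using h _ le_rfl
  intro k
  induction k with
  | zero => simp
  | succ k ih =>
    intro hk
    have ih := ih (by omega)
    have e0 := φ.map_rel (T.graph_adj_inl_inr.2 (hc k (by omega)).1)
    have e1 := φ.map_rel (T.graph_adj_inl_inr.2 (hc (k + 1) hk).1)
    have hflip : O.Adj (φ (.inl (c (k + 1)).1)) (φ (.inr (c (k + 1)).2)) ↔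
        ¬ O.Adj (φ (.inl (c k).1)) (φ (.inr (c k).2)) := by
      rcases hstep k hk with ⟨h, h'⟩ | ⟨h, h'⟩
      · have e2 : G.Adj (φ (.inl (c k).1)) (φ (.inl (c (k + 1)).1)) :=
          φ.map_rel (T.graph_adj_inl_inl.2 (by omega))
        rw [h'] at e1 ⊢
        rw [anti _ _ e1, adj_iff_of_isFree hO hfree e0 e1.symm e2]
      · have e2 : G.Adj (φ (.inr (c k).2)) (φ (.inr (c (k + 1)).2)) :=
          φ.map_rel (T.graph_adj_inr_inr.2 (by omega))
        rw [h] at e1 ⊢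
        rw [anti _ _ e1, adj_iff_of_isFree hO hfree e1.symm e0 e2.symm]
    rw [hflip, Nat.even_add_one]
    tauto

/-! ### Lattice paths and the t-joins they carry -/

/-- A homomorphic image in `G` of a t-join with `k` triangles, whose first chord is `d` and whose
last chord is `d'`. The paths are `x 0, …, x n` and `y 0, …, y m`, and `C` is the set of chords, a
chain with one element of every rank. -/
def HasStrip {V : Type*} (G : SimpleGraph V) (k : ℕ) (d d' : V × V) : Prop :=
  ∃ (n m : ℕ) (x y : ℕ → V) (C : Set (ℕ × ℕ)), n + m = k ∧ (x 0, y 0) = d ∧ (x n, y m) = d' ∧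
    (0, 0) ∈ C ∧ (n, m) ∈ C ∧ (∀ e ∈ C, e ≤ (n, m)) ∧ (∀ e ∈ C, ∀ f ∈ C, e ≤ f ∨ f ≤ e) ∧
    (∀ l ≤ k, ∃ e ∈ C, e.1 + e.2 = l) ∧ (∀ e ∈ C, G.Adj (x e.1) (y e.2)) ∧
    (∀ i < n, G.Adj (x i) (x (i + 1))) ∧ ∀ j < m, G.Adj (y j) (y (j + 1))

namespace HasStrip

variable {V : Type*} {G : SimpleGraph V} {k : ℕ} {d : V × V} {a b c : V}

theorem of_adj (h : G.Adj a b) : HasStrip G 0 (a, b) (a, b) := by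
  refine ⟨0, 0, fun _ => a, fun _ => b, {(0, 0)}, ?_⟩
  simp [h]

theorem swap {d' : V × V} (h : HasStrip G k d d') : HasStrip G k d.swap d'.swap := by
  obtain ⟨n, m, x, y, C, rfl, rfl, rfl, h0, h1, hle, hch, hex, hC, hx, hy⟩ := h
  refine ⟨m, n, y, x, Prod.swap ⁻¹' C, add_comm _ _, rfl, rfl, h0, h1, ?_, ?_, ?_, ?_, hy, hx⟩
  · exact fun e he => Prod.swap_le_swap.1 (hle _ he)
  · exact fun e he f hf => by simpa using hch _ he _ hf
  · intro l hl
    obtain ⟨e, he, h⟩ := hex l hl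
    exact ⟨e.swap, by simpa using he, by simp [← h, add_comm]⟩
  · exact fun e he => (hC _ he).symm

/-- Gluing a triangle on a vertex `c` to the last chord `ab` prolongs the first path by `c`. -/
theorem step_left (h : HasStrip G k d (a, b)) (hac : G.Adj a c) (hcb : G.Adj c b) :
    HasStrip G (k + 1) d (c, b) := by
  obtain ⟨n, m, x, y, C, rfl, rfl, hab, h0, h1, hle, hch, hex, hC, hx, hy⟩ := h
  obtain ⟨rfl, rfl⟩ := Prod.mk.inj hab
  have hup : ∀ i ≤ n, Function.update x (n + 1) c i = x i := fun i hi =>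
    Function.update_of_ne (by omega) _ _
  refine ⟨n + 1, m, Function.update x (n + 1) c, y, insert (n + 1, m) C, by omega, ?_, by simp,
    .inr h0, .inl rfl, ?_, ?_, ?_, ?_, ?_, hy⟩
  · rw [hup 0 (by omega)]
  · rintro e (rfl | he)
    · exact le_rfl
    · exact (hle e he).trans (Prod.mk_le_mk.2 ⟨by omega, le_rfl⟩)
  · have hlast : ∀ e ∈ C, e ≤ (n + 1, m) := fun e he =>
      (hle e he).trans (Prod.mk_le_mk.2 ⟨by omega, le_rfl⟩)
    rintro e (rfl | he) f (rfl | hf)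
    · exact .inl le_rfl
    · exact .inr (hlast f hf)
    · exact .inl (hlast e he)
    · exact hch e he f hf
  · intro l hl
    rcases Nat.lt_or_ge (n + m) l with h | h
    · exact ⟨_, .inl rfl, by simp only; omega⟩
    · obtain ⟨e, he, h⟩ := hex l h
      exact ⟨e, .inr he, h⟩
  · rintro e (rfl | he)
    · simpa using hcb
    · rw [hup _ (hle e he).1]
      exact hC e he
  · intro i hi
    rw [hup i (by omega)]
    rcases Nat.lt_or_ge i n with h | h
    · rw [hup _ h]
      exact hx i h
    · obtain rfl : i = n := by omega
      simpa using hac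

theorem step_right (h : HasStrip G k d (a, b)) (hbc : G.Adj b c) (hac : G.Adj a c) :
    HasStrip G (k + 1) d (a, c) := by
  simpa using (h.swap.step_left hbc hac.symm).swap

/-- A strip is the image of a t-join, drawn with its vertices at integer abscissas. -/
theorem exists_tEmbedding {d' : V × V} (h : HasStrip G k d d') :
    ∃ (n m : ℕ) (T : TEmbedding n m) (φ : T.graph →g G), n + m = k ∧
      (φ (.inl 0), φ (.inr 0)) = d ∧ (φ (.inl (Fin.last n)), φ (.inr (Fin.last m))) = d' := by
  obtain ⟨n, m, x, y, C, rfl, rfl, rfl, h0, h1, hle, hch, hex, hC, hx, hy⟩ := h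
  have hmono : ∀ N : ℕ, StrictMono fun i : Fin (N + 1) => ((i : ℕ) : ℝ) :=
    fun N i j hij => Nat.cast_lt.2 (Fin.lt_def.1 hij)
  let T : TEmbedding n m :=
    { posP := fun i => ((i : ℕ) : ℝ)
      posQ := fun j => ((j : ℕ) : ℝ)
      strictMono_posP := hmono n
      strictMono_posQ := hmono m
      chords := {e | ((e.1 : ℕ), (e.2 : ℕ)) ∈ C}
      first_mem := by simpa using h0
      last_mem := by simpa using h1
      noncrossing := fun e he f hf hne =>
        (disjoint_chordSegment_iff (hmono n) (hmono m) e f).2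
          ((hch _ he _ hf).imp (fun h => lt_of_le_of_ne h hne)
            fun h => lt_of_le_of_ne h hne.symm)
      maximal := by
        intro e he
        -- the chord of the same rank as `e` crosses `e`
        obtain ⟨f, hf, hr⟩ := hex ((e.1 : ℕ) + e.2) (by omega)
        have hf' := hle f hf
        refine ⟨(⟨f.1, Nat.lt_succ_of_le hf'.1⟩, ⟨f.2, Nat.lt_succ_of_le hf'.2⟩), hf, ?_⟩
        rw [disjoint_chordSegment_iff (hmono n) (hmono m)]
        simp only [Prod.lt_iff, Fin.lt_def, Fin.le_def]
        omega }
  have hT : ∀ u v, T.graph.Adj u v →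
      G.Adj (Sum.elim (fun i : Fin (n + 1) => x i) (fun j : Fin (m + 1) => y j) u)
        (Sum.elim (fun i : Fin (n + 1) => x i) (fun j : Fin (m + 1) => y j) v) := by
    have hx' : ∀ i j : Fin (n + 1), (i : ℕ) + 1 = j → G.Adj (x i) (x j) := fun i j h => by
      rw [← h]; exact hx i (by omega)
    have hy' : ∀ i j : Fin (m + 1), (i : ℕ) + 1 = j → G.Adj (y i) (y j) := fun i j h => by
      rw [← h]; exact hy i (by omega)
    rintro (u | u) (v | v) h
    · exact (T.graph_adj_inl_inl.1 h).elim (hx' u v) fun h => (hx' v u h).symm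
    · exact hC _ (T.graph_adj_inl_inr.1 h)
    · exact (hC _ (T.graph_adj_inr_inl.1 h)).symm
    · exact (T.graph_adj_inr_inr.1 h).elim (hy' u v) fun h => (hy' v u h).symm
  exact ⟨n, m, T, ⟨_, fun {u v} h => hT u v h⟩, rfl, by simp, by simp⟩

/-- A strip of odd length returning to its first chord closes up to an odd donut. -/
theorem exists_oddDonut (h : HasStrip G k (a, b) (a, b)) (hk : Odd k) :
    ∃ (W : Type) (D : SimpleGraph W), IsOddDonut D ∧ Nonempty (D →g G) := by
  obtain ⟨n, m, T, φ, rfl, h0, h1⟩ := h.exists_tEmbedding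
  obtain ⟨rfl, rfl⟩ := Prod.mk.inj h0
  obtain ⟨hP, hQ⟩ := Prod.mk.inj h1
  obtain ⟨hq, hhom⟩ := isLooplessQuotient_of_hom φ (r := DonutRel n m) (by
    rintro _ _ (_ | _)
    exacts [hP.symm, hQ.symm])
  refine ⟨_, _, ⟨n, m, T, ?_, by rwa [T.numTriangles_eq], hq⟩, hhom⟩
  by_contra hlt
  -- a single triangle would put an edge between two identified vertices
  have hnm : n + m = 1 := by
    obtain ⟨l, hl⟩ := hk
    omega
  rcases Nat.eq_zero_or_pos n with rfl | hn
  · refine (φ.map_rel (a := .inr 0) (b := .inr (Fin.last m)) ?_).ne hQ.symm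
    simp; omega
  · refine (φ.map_rel (a := .inl 0) (b := .inl (Fin.last n)) ?_).ne hP.symm
    simp; omega

/-- A strip of even length whose last chord is the first one with its ends exchanged closes up to
an even Möbius donut. -/
theorem exists_evenMobiusDonut (h : HasStrip G k (a, b) (b, a)) (hk : Even k) :
    ∃ (W : Type) (D : SimpleGraph W), IsEvenMobiusDonut D ∧ Nonempty (D →g G) := by
  obtain ⟨n, m, T, φ, rfl, h0, h1⟩ := h.exists_tEmbedding
  obtain ⟨rfl, rfl⟩ := Prod.mk.inj h0
  obtain ⟨hP, hQ⟩ := Prod.mk.inj h1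
  obtain ⟨hq, hhom⟩ := isLooplessQuotient_of_hom φ (r := MobiusRel n m) (by
    rintro _ _ (_ | _)
    exacts [hQ.symm, hP.symm])
  refine ⟨_, _, ⟨n, m, T, ?_, by rwa [T.numTriangles_eq], hq⟩, hhom⟩
  by_contra hlt
  -- a strip without triangles is a single edge, whose ends would be identified
  obtain ⟨rfl, rfl⟩ : n = 0 ∧ m = 0 := by
    obtain ⟨l, hl⟩ := hk
    omega
  exact (φ.map_rel (T.graph_adj_inl_inr.2 T.first_mem)).ne hP

end HasStrip

/-! ### Orienting along rotation classes -/

/-- Two consecutive arcs of a directed triangle of `G`, in either order. Such arcs have to be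
both present or both absent in an orientation without transitive triangles. -/
def Rotates {V : Type*} (G : SimpleGraph V) (d d' : V × V) : Prop :=
  ∃ c, G.Adj d.1 d.2 ∧ G.Adj d.2 c ∧ G.Adj d.1 c ∧ (d' = (d.2, c) ∨ d' = (c, d.1))

section Rotates

variable {V : Type*} {G : SimpleGraph V}

/-- Each rotation moves to the next chord of a strip and exchanges its ends, so the ends are
exchanged after an odd number of rotations. -/
theorem exists_hasStrip_of_rotates {d d' : V × V} (hd : G.Adj d.1 d.2)
    (h : Relation.ReflTransGen (Rotates G) d d') :
    ∃ k, (Even k ∧ HasStrip G k d d') ∨ (Odd k ∧ HasStrip G k d d'.swap) := by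
  induction h with
  | refl => exact ⟨0, .inl ⟨Even.zero, .of_adj hd⟩⟩
  | @tail e f _ hef ih =>
    obtain ⟨a, b⟩ := e
    obtain ⟨c, -, hbc, hac, rfl | rfl⟩ := hef <;> obtain ⟨k, ⟨hk, h⟩ | ⟨hk, h⟩⟩ := ih
    · exact ⟨k + 1, .inr ⟨hk.add_one, h.step_left hac hbc.symm⟩⟩
    · exact ⟨k + 1, .inl ⟨hk.add_one, h.step_right hac hbc⟩⟩
    · exact ⟨k + 1, .inr ⟨hk.add_one, h.step_right hbc hac⟩⟩
    · exact ⟨k + 1, .inl ⟨hk.add_one, h.step_left hbc hac.symm⟩⟩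

instance instSymmRotates : Std.Symm (Rotates G) where
  symm := by
    rintro ⟨a, b⟩ _ ⟨c, hab, hbc, hac, rfl | rfl⟩
    · exact ⟨a, hbc, hac.symm, hab.symm, .inr rfl⟩
    · exact ⟨b, hac.symm, hab, hbc.symm, .inl rfl⟩

/-- If no arc can be rotated into its reverse, then there is an orientation without transitive
triangles: the rotation classes are well-ordered, and an edge gets the direction whose class is
the smaller one. -/
theorem exists_isFree_of_not_rotates
    (h : ∀ a b, G.Adj a b → ¬ Relation.ReflTransGen (Rotates G) (a, b) (b, a)) :
    ∃ O : Digraph V, IsOrientation O G ∧ IsFree T3 O := by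
  let cls : V → V → Quot (Rotates G) := fun a b => Quot.mk _ (a, b)
  have hcls : ∀ a b, G.Adj a b → cls a b ≠ cls b a := by
    intro a b hab heq
    exact h a b hab
      (Relation.EqvGen.eqvGen_eq_reflTransGen (r := Rotates G) ▸ Quot.eqvGen_exact heq)
  have hrot : ∀ a b c, G.Adj a b → G.Adj b c → G.Adj a c → cls a b = cls b c :=
    fun a b c hab hbc hac => Quot.sound ⟨c, hab, hbc, hac, .inl rfl⟩
  refine ⟨⟨fun a b => G.Adj a b ∧ WellOrderingRel (cls a b) (cls b a)⟩, ⟨?_, ?_⟩, ⟨fun f => ?_⟩⟩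
  · intro a b
    constructor
    · intro hab
      rcases trichotomous_of WellOrderingRel (cls a b) (cls b a) with hlt | heq | hgt
      · exact .inl ⟨hab, hlt⟩
      · exact (hcls a b hab heq).elim
      · exact .inr ⟨hab.symm, hgt⟩
    · rintro (h | h)
      exacts [h.1, h.1.symm]
  · rintro a b ⟨-, h1⟩ ⟨-, h2⟩
    exact asymm_of WellOrderingRel h1 h2
  · obtain ⟨h01, l01⟩ := f.map_rel_iff.2 (show (0 : Fin 3) < 1 by decide)
    obtain ⟨h12, -⟩ := f.map_rel_iff.2 (show (1 : Fin 3) < 2 by decide)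
    obtain ⟨h02, l02⟩ := f.map_rel_iff.2 (show (0 : Fin 3) < 2 by decide)
    -- `(2, 0)` lies in the class of `(0, 1)`, and `(0, 2)` in that of `(1, 0)`
    rw [hrot _ _ _ h01 h12 h02, hrot _ _ _ h12 h02.symm h01.symm,
      hrot _ _ _ h01.symm h02 h12] at l01
    exact asymm_of WellOrderingRel l01 l02

end Rotates

end TriangleOrient

theorem mainTheorem1 {V : Type*} (G : SimpleGraph V) :
    (∃ O : Digraph V, TriangleOrient.IsOrientation O G ∧
        TriangleOrient.IsFree TriangleOrient.T3 O) ↔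
      ∀ (W : Type) (D : SimpleGraph W),
        TriangleOrient.IsOddDonut D ∨ TriangleOrient.IsEvenMobiusDonut D →
          IsEmpty (D →g G) := by
  constructor
  · rintro ⟨O, hO, hfree⟩ W D hD
    refine ⟨fun φ => ?_⟩
    rcases hD with ⟨n, m, T, -, hpar, hq⟩ | ⟨n, m, T, -, hpar, hq⟩ <;>
      rw [T.numTriangles_eq] at hpar <;> obtain ⟨ψ, hψ⟩ := hq.exists_hom φ
    · have h := T.adj_last_iff hO hfree ψ
      rw [← hψ _ _ .left, ← hψ _ _ .right] at h
      exact Nat.not_even_iff_odd.2 hpar (h.1 Iff.rfl)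
    · have h := T.adj_last_iff hO hfree ψ
      rw [← hψ _ _ .left, ← hψ _ _ .right] at h
      -- the last chord is the first one with its ends exchanged
      have hadj := ψ.map_rel (T.graph_adj_inl_inr.2 T.first_mem)
      have h1 := (hO.1 _ _).1 hadj
      have h2 := hO.2 (ψ (.inl 0)) (ψ (.inr 0))
      have := h.2 hpar
      tauto
  · intro hno
    refine TriangleOrient.exists_isFree_of_not_rotates fun a b hab hrot => ?_
    obtain ⟨k, ⟨hk, h⟩ | ⟨hk, h⟩⟩ := TriangleOrient.exists_hasStrip_of_rotates hab hrot
    · obtain ⟨W, D, hD, ⟨φ⟩⟩ := h.exists_evenMobiusDonut hk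
      exact (hno W D (.inr hD)).false φ
    · obtain ⟨W, D, hD, ⟨φ⟩⟩ := h.exists_oddDonut hk
      exact (hno W D (.inl hD)).false φ
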